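/- Let $q$ be a prime power, $\mathbb{F}_q$ the field with $q$ elements, and $\widehat{\mathcal K}$ the $T^{-1}$-adic completion of $\mathbb{F}_q(T)$; infinite sums and products are taken in the $T^{-1}$-adic topology. Put $D_j=\prod_{i=0}^{j-1}\left(T^{q^j}-T^{q^i}\right)$ for $j\ge 0$ (so $D_0=1$). Let $\sqrt[q-1]{-T}$ be any $(q-1)$-st root of $-T$ in any field extension of $\widehat{\mathcal K}$, and put $$\overline{\pi}=\frac{T\,\sqrt[q-1]{-T}}{\prod_{A\in\mathbb{F}_q[T]\setminus\{0\}}\left(1-(TA)^{-1}\right)},$$ where the product converges in $\widehat{\mathcal K}$ to a nonzero element. For an integer $\ell\ge 0$ let $$\boldsymbol e_\ell\left(1/A^{q-1}\right)_{A\ \mathrm{monic}}=\sum_{S}\ \prod_{A\in S}\frac{1}{A^{q-1}},$$ where $S$ runs over the $\ell$-element sets of monic polynomials in $\mathbb{F}_q[T]$. Then for every $\ell\ge 0$ this sum converges in $\widehat{\mathcal K}$, and $$\boldsymbol e_\ell\left(1/A^{q-1}\right)_{A\ \mathrm{monic}}=\begin{cases}(-1)^\ell\,\overline{\pi}^{\,\ell(q-1)}/D_j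 & \text{if } \ell=\frac{q^j-1}{q-1}\text{ for some integer } j\ge 0,\\ 0&\text{otherwise.}\end{cases}$$ -/

import Mathlib

open Polynomial

noncomputable section

/-- The elementary symmetric function of degree `l` evaluated at a (possibly infinite) family `x`:
the unordered sum, over all `l`-element sets `s` of indices, of the products `∏ i ∈ s, x i`. -/
def infiniteESymm {ι R : Type*} [CommRing R] [TopologicalSpace R] (l : ℕ) (x : ι → R) : R :=
  ∑' s : {s : Finset ι // s.card = l}, ∏ i ∈ s.1, x i

/-- The polynomial `D_j = ∏_{i < j} (T ^ (q ^ j) - T ^ (q ^ i))` of `𝔽_q[T]`, with `D_0 = 1`. -/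
def carlitzD (Fq : Type*) [Field Fq] [Fintype Fq] (j : ℕ) : Fq[X] :=
  ∏ i ∈ Finset.range j,
    ((X : Fq[X]) ^ Fintype.card Fq ^ j - (X : Fq[X]) ^ Fintype.card Fq ^ i)

section Infinity

variable (Fq : Type*) [Field Fq] [DecidableEq (RatFunc Fq)]

/-- The inclusion of `𝔽_q[T]` into the completion of `𝔽_q(T)` at infinity, that is, into its
`T⁻¹`-adic completion. -/
def polyToInfty : Fq[X] →+* RatFunc.CompletionAtInfty Fq :=
  (algebraMap (RatFunc Fq) (RatFunc.CompletionAtInfty Fq)).comp (algebraMap Fq[X] (RatFunc Fq))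

/-- The factor `1 - (T A)⁻¹` attached to a nonzero polynomial `A`. -/
def periodFactor (A : {A : Fq[X] // A ≠ 0}) : RatFunc.CompletionAtInfty Fq :=
  1 - (polyToInfty Fq (X * A.1))⁻¹

/-- The Carlitz period `T * r / ∏_{A ≠ 0} (1 - (T A)⁻¹)` attached to an element `r` of an extension
`L` of the completion; here `r` is meant to be a `(q - 1)`-st root of `-T`. -/
def carlitzPeriod {L : Type*} [Field L] [Algebra (RatFunc.CompletionAtInfty Fq) L] (r : L) : L :=
  algebraMap (RatFunc.CompletionAtInfty Fq) L (polyToInfty Fq X) * r /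
    algebraMap (RatFunc.CompletionAtInfty Fq) L (∏' A : {A : Fq[X] // A ≠ 0}, periodFactor Fq A)

/-- The family `1 / A ^ (q - 1)`, indexed by the monic polynomials `A` of `𝔽_q[T]`. -/
def monicInvPow [Fintype Fq] (A : {A : Fq[X] // A.Monic}) : RatFunc.CompletionAtInfty Fq :=
  1 / polyToInfty Fq A.1 ^ (Fintype.card Fq - 1)

end Infinity

end

/-! ### The `q`-power Frobenius over `𝔽_q` -/

noncomputable section

/-! Let `e_d(z) = ∏_{deg A < d} (z - A)`. The roots form an `𝔽_q`-space, so `e_d` is `𝔽_q`-linear,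
and Carlitz's coefficients are explicit: that of `z^(q^i)` is `c_{d,i} = (-1)^(d-i) D_d / (D_i
L_{d-i}^(q^i))` (`eval_carlitzPoly_eq_prod`). Grouping the nonzero `A` by scalar multiples gives
`e_d(z) = c_{d,0} z ∏_{A monic} (1 - z^(q-1) / A^(q-1))`. Comparing coefficients of `z^(l(q-1)+1)`,
the `l`-th symmetric function over monic `A` of degree `< d` is `0` unless `l(q-1)+1 = q^j`, and is
then `(-1)^l c_{d,j} / c_{d,0}`.

The period enters at `z = 1/T`: the functional equation expressing `e_{d+1}(Tz)` through
`e_{d+1}(z)` and `e_d(z)^q`, with `e_{d+1}(1) = 0`, determines `e_d(1/T)^(q-1)`, hence the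
`(q-1)`-st power of the partial product of the `1 - 1/(TA)` in terms of `L_d`
(`prod_nonzeroDegreeLT_pow`). Eliminating `L_d` gives an exact finite formula whose limit is read
off termwise (`sum_powersetCard_monicDegreeLT_eq_prod`). Convergence is nonarchimedean: families
tending to `0` are summable. -/

theorem sub_pow_fintypeCard {Fq R : Type*} [Field Fq] [Fintype Fq] [CommRing R] (φ : Fq →+* R)
    (x y : R) : (x - y) ^ Fintype.card Fq = x ^ Fintype.card Fq - y ^ Fintype.card Fq := by
  let := φ.toAlgebra
  simpa using map_sub (FiniteField.frobeniusAlgHom Fq R) x y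

theorem sum_pow_fintypeCard {Fq R ι : Type*} [Field Fq] [Fintype Fq] [CommRing R] (φ : Fq →+* R)
    (s : Finset ι) (f : ι → R) :
    (∑ i ∈ s, f i) ^ Fintype.card Fq = ∑ i ∈ s, f i ^ Fintype.card Fq := by
  let := φ.toAlgebra
  simpa only [FiniteField.coe_frobeniusAlgHom] using map_sum (FiniteField.frobeniusAlgHom Fq R) f s

theorem sub_pow_fintypeCard_pow {Fq R : Type*} [Field Fq] [Fintype Fq] [CommRing R] (φ : Fq →+* R)
    (x y : R) (n : ℕ) :
    (x - y) ^ Fintype.card Fq ^ n = x ^ Fintype.card Fq ^ n - y ^ Fintype.card Fq ^ n := by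
  induction n with
  | zero => simp
  | succ n ih => rw [pow_succ, pow_mul, ih, sub_pow_fintypeCard φ, ← pow_mul, ← pow_mul]

theorem neg_one_pow_fintypeCard_sub_one {Fq R : Type*} [Field Fq] [Fintype Fq] [CommRing R]
    (φ : Fq →+* R) : (-1 : R) ^ (Fintype.card Fq - 1) = 1 := by
  have h := congrArg φ (FiniteField.pow_card_sub_one_eq_one (-1 : Fq) (by simp))
  simpa using h

theorem neg_one_pow_fintypeCard_pow {Fq R : Type*} [Field Fq] [Fintype Fq] [CommRing R]
    (φ : Fq →+* R) (n : ℕ) : (-1 : R) ^ Fintype.card Fq ^ n = -1 := by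
  have h := congrArg φ (FiniteField.pow_card_pow n (-1 : Fq))
  simpa using h

/-- The polynomial `L_d = ∏_{1 ≤ k ≤ d} (T ^ (q ^ k) - T)`. -/
def carlitzL (Fq : Type*) [Field Fq] [Fintype Fq] (d : ℕ) : Fq[X] :=
  ∏ k ∈ Finset.range d, ((X : Fq[X]) ^ Fintype.card Fq ^ (k + 1) - X)

/-! ### Carlitz's linear polynomials: coefficients, recursion, special values -/

section Carlitz

variable {Fq K : Type*} [Field Fq] [Fintype Fq] [Field K]

theorem carlitzD_zero : carlitzD Fq 0 = 1 := by simp [carlitzD]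

theorem carlitzL_zero : carlitzL Fq 0 = 1 := by simp [carlitzL]

theorem carlitzL_succ (d : ℕ) :
    carlitzL Fq (d + 1) = carlitzL Fq d * (X ^ Fintype.card Fq ^ (d + 1) - X) := by
  simp [carlitzL, Finset.prod_range_succ]

theorem carlitzD_succ (d : ℕ) : carlitzD Fq (d + 1) =
    carlitzD Fq d ^ Fintype.card Fq * (X ^ Fintype.card Fq ^ (d + 1) - X) := by
  rw [carlitzD, Finset.prod_range_succ', carlitzD, ← Finset.prod_pow]
  congr 1
  · refine Finset.prod_congr rfl fun i _ => ?_
    rw [sub_pow_fintypeCard (C : Fq →+* Fq[X]), ← pow_mul, ← pow_mul, pow_succ, pow_succ]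
  · simp

theorem X_pow_card_pow_sub_X_ne_zero (d : ℕ) :
    (X ^ Fintype.card Fq ^ (d + 1) - X : Fq[X]) ≠ 0 :=
  FiniteField.X_pow_card_pow_sub_X_ne_zero _ (by simp) Fintype.one_lt_card

theorem carlitzL_ne_zero (d : ℕ) : carlitzL Fq d ≠ 0 :=
  Finset.prod_ne_zero_iff.2 fun k _ => X_pow_card_pow_sub_X_ne_zero k

theorem carlitzD_ne_zero (d : ℕ) : carlitzD Fq d ≠ 0 := by
  induction d with
  | zero => simp [carlitzD_zero]
  | succ d ih =>
    rw [carlitzD_succ]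
    exact mul_ne_zero (pow_ne_zero _ ih) (X_pow_card_pow_sub_X_ne_zero d)

/-- The coefficient of `z ^ (q ^ i)` in `∏_{deg A < d} (z - A)`. -/
def carlitzCoeff (φ : Fq[X] →+* K) (d i : ℕ) : K :=
  if i ≤ d then (-1) ^ (d - i) * φ (carlitzD Fq d) /
    (φ (carlitzD Fq i) * φ (carlitzL Fq (d - i)) ^ Fintype.card Fq ^ i) else 0

theorem carlitzCoeff_add (φ : Fq[X] →+* K) (i k : ℕ) : carlitzCoeff φ (i + k) i =
    (-1) ^ k * φ (carlitzD Fq (i + k)) /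
      (φ (carlitzD Fq i) * φ (carlitzL Fq k) ^ Fintype.card Fq ^ i) := by
  simp [carlitzCoeff]

theorem carlitzCoeff_self {φ : Fq[X] →+* K} (hφ : Function.Injective φ) (d : ℕ) :
    carlitzCoeff φ d d = 1 := by
  have h : φ (carlitzD Fq d) ≠ 0 := (map_ne_zero_iff φ hφ).2 (carlitzD_ne_zero d)
  simp [carlitzCoeff, carlitzL_zero, h]

theorem carlitzCoeff_zero_right (φ : Fq[X] →+* K) (d : ℕ) : carlitzCoeff φ d 0 =
    (-1) ^ d * φ (carlitzD Fq d) / φ (carlitzL Fq d) := by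
  simp [carlitzCoeff, carlitzD_zero]

theorem carlitzCoeff_zero_ne_zero {φ : Fq[X] →+* K} (hφ : Function.Injective φ) (d : ℕ) :
    carlitzCoeff φ d 0 ≠ 0 := by
  rw [carlitzCoeff_zero_right]
  exact div_ne_zero (mul_ne_zero (by simp) ((map_ne_zero_iff φ hφ).2 (carlitzD_ne_zero d)))
    ((map_ne_zero_iff φ hφ).2 (carlitzL_ne_zero d))

theorem carlitzCoeff_of_lt (φ : Fq[X] →+* K) {d i : ℕ} (h : d < i) : carlitzCoeff φ d i = 0 :=
  if_neg (not_le.2 h)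

/-- Both coefficients involve the same `L_{d-i}`, so only `D_{n+1} = D_n^q (T^(q^(n+1)) - T)` for `n
= d, i` matters. This is the functional equation under `z ↦ Tz`, coefficient by coefficient. -/
theorem carlitzCoeff_mul_sub {φ : Fq[X] →+* K} (hφ : Function.Injective φ) (d i : ℕ) :
    (φ X ^ Fintype.card Fq ^ (i + 1) - φ X) * carlitzCoeff φ (d + 1) (i + 1) =
      (φ X ^ Fintype.card Fq ^ (d + 1) - φ X) * carlitzCoeff φ d i ^ Fintype.card Fq := by
  rcases lt_or_ge d i with h | h
  · simp [carlitzCoeff_of_lt φ h, carlitzCoeff_of_lt φ (Nat.succ_lt_succ h)]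
  obtain ⟨k, rfl⟩ := Nat.exists_eq_add_of_le h
  have hD (j) : φ (carlitzD Fq j) ≠ 0 := (map_ne_zero_iff φ hφ).2 (carlitzD_ne_zero j)
  have hL (j) : φ (carlitzL Fq j) ≠ 0 := (map_ne_zero_iff φ hφ).2 (carlitzL_ne_zero j)
  have hb : φ X ^ Fintype.card Fq ^ (i + 1) - φ X ≠ 0 := by
    simpa using (map_ne_zero_iff φ hφ).2 (X_pow_card_pow_sub_X_ne_zero (Fq := Fq) i)
  have h1 : carlitzCoeff φ (i + k + 1) (i + 1) = _ :=
    (by rw [add_right_comm] : _ = carlitzCoeff φ (i + 1 + k) (i + 1)).trans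
      (carlitzCoeff_add φ (i + 1) k)
  have hs : ((-1 : K) ^ k) ^ Fintype.card Fq = (-1) ^ k := by
    rw [pow_right_comm]
    simpa using congrArg (· ^ k) (neg_one_pow_fintypeCard_pow (φ.comp C) 1)
  rw [h1, carlitzCoeff_add, add_right_comm i 1 k, carlitzD_succ, carlitzD_succ i]
  simp only [map_mul, map_sub, map_pow, div_pow, mul_pow, hs]
  rw [← pow_mul, ← pow_succ]
  have := hD i
  have := hD (i + k)
  have := hL k
  field_simp

/-- After multiplication by `T^(q^(i+1)) - T`, the claim rests on splitting `T^(q^(d+1)) - T` as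
`(T^(q^(d+1)) - T^(q^(i+1))) + (T^(q^(i+1)) - T)`; the first summand cancels against the last factor
of `L_{d-i}^(q^(i+1))`. -/
theorem carlitzCoeff_succ_succ {φ : Fq[X] →+* K} (hφ : Function.Injective φ) (d i : ℕ) :
    carlitzCoeff φ (d + 1) (i + 1) = carlitzCoeff φ d i ^ Fintype.card Fq -
      φ (carlitzD Fq d) ^ (Fintype.card Fq - 1) * carlitzCoeff φ d (i + 1) := by
  rcases lt_trichotomy d i with h | rfl | h
  · simp [carlitzCoeff_of_lt φ h, carlitzCoeff_of_lt φ (Nat.succ_lt_succ h),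
      carlitzCoeff_of_lt φ (h.trans i.lt_succ_self)]
  · simp [carlitzCoeff_self hφ, carlitzCoeff_of_lt φ d.lt_succ_self]
  obtain ⟨k, rfl⟩ := Nat.exists_eq_add_of_lt h
  have hD (j) : φ (carlitzD Fq j) ≠ 0 := (map_ne_zero_iff φ hφ).2 (carlitzD_ne_zero j)
  have hL (j) : φ (carlitzL Fq j) ≠ 0 := (map_ne_zero_iff φ hφ).2 (carlitzL_ne_zero j)
  have hb (j) : φ X ^ Fintype.card Fq ^ (j + 1) - φ X ≠ 0 := by
    simpa using (map_ne_zero_iff φ hφ).2 (X_pow_card_pow_sub_X_ne_zero (Fq := Fq) j)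
  refine mul_left_cancel₀ (hb i) ?_
  rw [mul_sub, carlitzCoeff_mul_sub hφ]
  have h1 : carlitzCoeff φ (i + k + 1) (i + 1) = _ :=
    (by rw [add_right_comm] : _ = carlitzCoeff φ (i + 1 + k) (i + 1)).trans
      (carlitzCoeff_add φ (i + 1) k)
  have hs : ((-1 : K) ^ (k + 1)) ^ Fintype.card Fq = (-1) ^ (k + 1) := by
    rw [pow_right_comm]
    simpa using congrArg (· ^ (k + 1)) (neg_one_pow_fintypeCard_pow (φ.comp C) 1)
  have h2 : (φ (carlitzL Fq (k + 1)) ^ Fintype.card Fq ^ i) ^ Fintype.card Fq =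
      φ (carlitzL Fq k) ^ Fintype.card Fq ^ (i + 1) *
      (φ X ^ Fintype.card Fq ^ (i + k + 1 + 1) - φ X ^ Fintype.card Fq ^ (i + 1)) := by
    rw [← pow_mul, ← pow_succ, carlitzL_succ, map_mul, mul_pow, map_sub, map_pow,
      sub_pow_fintypeCard_pow (φ.comp C), ← pow_mul, ← pow_add,
      show k + 1 + (i + 1) = i + k + 1 + 1 by ring]
  have h3 : φ X ^ Fintype.card Fq ^ (i + k + 1 + 1) - φ X ^ Fintype.card Fq ^ (i + 1) ≠ 0 := by
    intro h0
    rw [h0, mul_zero] at h2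
    exact pow_ne_zero _ (pow_ne_zero _ (hL (k + 1))) h2
  have h4 : φ (carlitzD Fq (i + k + 1)) ^ Fintype.card Fq =
      φ (carlitzD Fq (i + k + 1)) ^ (Fintype.card Fq - 1) * φ (carlitzD Fq (i + k + 1)) := by
    rw [← pow_succ, Nat.sub_add_cancel Fintype.card_pos]
  rw [h1, show i + k + 1 = i + (k + 1) from rfl, carlitzCoeff_add, add_right_comm i 1 k,
    carlitzD_succ i, show i + (k + 1) = i + k + 1 from rfl]
  simp only [map_mul, map_sub, map_pow, div_pow, mul_pow, hs, h2, h4]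
  have := hD i
  have := hD (i + k + 1)
  have := hL k
  have := hb i
  field_simp
  ring

/-- The `𝔽_q`-linear polynomial `∑_{i ≤ d} c_{d, i} z ^ (q ^ i)`. -/
def carlitzPoly (φ : Fq[X] →+* K) (d : ℕ) : K[X] :=
  ∑ i ∈ Finset.range (d + 1), C (carlitzCoeff φ d i) * X ^ Fintype.card Fq ^ i

theorem eval_carlitzPoly (φ : Fq[X] →+* K) (d : ℕ) (z : K) : (carlitzPoly φ d).eval z =
    ∑ i ∈ Finset.range (d + 1), carlitzCoeff φ d i * z ^ Fintype.card Fq ^ i := by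
  simp [carlitzPoly, eval_finsetSum]

theorem eval_carlitzPoly_sub (φ : Fq[X] →+* K) (d : ℕ) (y z : K) :
    (carlitzPoly φ d).eval (y - z) = (carlitzPoly φ d).eval y - (carlitzPoly φ d).eval z := by
  simp only [eval_carlitzPoly, ← Finset.sum_sub_distrib, ← mul_sub,
    sub_pow_fintypeCard_pow (φ.comp C)]

theorem eval_carlitzPoly_C_mul (φ : Fq[X] →+* K) (d : ℕ) (c : Fq) (z : K) :
    (carlitzPoly φ d).eval (φ (C c) * z) = φ (C c) * (carlitzPoly φ d).eval z := by
  simp only [eval_carlitzPoly, Finset.mul_sum, mul_pow, ← map_pow, FiniteField.pow_card_pow]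
  exact Finset.sum_congr rfl fun i _ => by ring

theorem eval_carlitzPoly_succ {φ : Fq[X] →+* K} (hφ : Function.Injective φ) (d : ℕ) (z : K) :
    (carlitzPoly φ (d + 1)).eval z = (carlitzPoly φ d).eval z ^ Fintype.card Fq -
      φ (carlitzD Fq d) ^ (Fintype.card Fq - 1) * (carlitzPoly φ d).eval z := by
  -- The coefficient of `z` receives nothing from the `q`-th power, so it is outside
  -- `carlitzCoeff_succ_succ`.
  have hz : carlitzCoeff φ (d + 1) 0 =
      -(φ (carlitzD Fq d) ^ (Fintype.card Fq - 1) * carlitzCoeff φ d 0) := by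
    have hb : φ X ^ Fintype.card Fq ^ (d + 1) - φ X ≠ 0 := by
      simpa using (map_ne_zero_iff φ hφ).2 (X_pow_card_pow_sub_X_ne_zero (Fq := Fq) d)
    have hL : φ (carlitzL Fq d) ≠ 0 := (map_ne_zero_iff φ hφ).2 (carlitzL_ne_zero d)
    have h4 : φ (carlitzD Fq d) ^ Fintype.card Fq =
        φ (carlitzD Fq d) ^ (Fintype.card Fq - 1) * φ (carlitzD Fq d) := by
      rw [← pow_succ, Nat.sub_add_cancel Fintype.card_pos]
    rw [carlitzCoeff_zero_right, carlitzCoeff_zero_right, carlitzD_succ, carlitzL_succ]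
    simp only [map_mul, map_sub, map_pow, h4]
    field_simp
    ring
  -- Padding with `c_{d,d+1} = 0` aligns the ranges of summation.
  have hd : (carlitzPoly φ d).eval z =
      ∑ i ∈ Finset.range (d + 1 + 1), carlitzCoeff φ d i * z ^ Fintype.card Fq ^ i := by
    rw [Finset.sum_range_succ, carlitzCoeff_of_lt φ d.lt_succ_self, zero_mul, add_zero,
      eval_carlitzPoly]
  have hp : (carlitzPoly φ d).eval z ^ Fintype.card Fq =
      ∑ i ∈ Finset.range (d + 1),
        carlitzCoeff φ d i ^ Fintype.card Fq * z ^ Fintype.card Fq ^ (i + 1) := by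
    rw [eval_carlitzPoly, sum_pow_fintypeCard (φ.comp C)]
    exact Finset.sum_congr rfl fun i _ => by rw [mul_pow, ← pow_mul, ← pow_succ]
  rw [hp, hd, eval_carlitzPoly, Finset.sum_range_succ',
    Finset.sum_range_succ' _ (d + 1), hz, mul_add,
    Finset.mul_sum, ← sub_sub, ← Finset.sum_sub_distrib, neg_mul, ← sub_eq_add_neg, mul_assoc]
  congr 1
  refine Finset.sum_congr rfl fun i _ => ?_
  rw [carlitzCoeff_succ_succ hφ]
  ring

theorem eval_carlitzPoly_succ_mul {φ : Fq[X] →+* K} (hφ : Function.Injective φ) (d : ℕ) (z : K) :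
    (carlitzPoly φ (d + 1)).eval (φ X * z) = φ X * (carlitzPoly φ (d + 1)).eval z +
      (φ X ^ Fintype.card Fq ^ (d + 1) - φ X) * (carlitzPoly φ d).eval z ^ Fintype.card Fq := by
  simp only [eval_carlitzPoly]
  rw [sum_pow_fintypeCard (φ.comp C), Finset.sum_range_succ', Finset.sum_range_succ' _ (d + 1),
    mul_add, Finset.mul_sum, Finset.mul_sum, add_right_comm, ← Finset.sum_add_distrib]
  congr 1
  · refine Finset.sum_congr rfl fun i _ => ?_
    linear_combination (z ^ Fintype.card Fq ^ (i + 1)) * carlitzCoeff_mul_sub hφ d i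
  · ring

/-- By induction `e_{d+1}(T^d) = D_d^q - D_d^(q-1) D_d = 0`, so the functional equation at `z = T^d`
leaves only `(T^(q^(d+1)) - T) D_d^q`. -/
theorem eval_carlitzPoly_X_pow {φ : Fq[X] →+* K} (hφ : Function.Injective φ) (d : ℕ) :
    (carlitzPoly φ d).eval (φ X ^ d) = φ (carlitzD Fq d) := by
  induction d with
  | zero => simp [eval_carlitzPoly, carlitzCoeff_self hφ, carlitzD_zero]
  | succ d ih =>
    rw [pow_succ', eval_carlitzPoly_succ_mul hφ, eval_carlitzPoly_succ hφ, ih, ← pow_succ,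
      Nat.sub_add_cancel Fintype.card_pos, carlitzD_succ]
    simp [mul_comm]

theorem eval_carlitzPoly_one {φ : Fq[X] →+* K} (hφ : Function.Injective φ) (d : ℕ) :
    (carlitzPoly φ (d + 1)).eval 1 = 0 := by
  have h1 : Fintype.card Fq - 1 ≠ 0 := (Nat.sub_pos_of_lt Fintype.one_lt_card).ne'
  induction d with
  | zero =>
    rw [eval_carlitzPoly_succ hφ]
    simp [eval_carlitzPoly, carlitzCoeff_self hφ, carlitzD_zero]
  | succ d ih => rw [eval_carlitzPoly_succ hφ, ih]; simp

/-- The functional equation at `z = 1/T` has left side `e_{d+1}(1) = 0`. Substituting the recursion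
for `e_{d+1}(1/T)` cancels the terms `T e_d(1/T)^q`, and one factor `e_d(1/T)` is divided out. -/
theorem eval_carlitzPoly_inv_pow {φ : Fq[X] →+* K} (hφ : Function.Injective φ) (d : ℕ)
    (h : (carlitzPoly φ d).eval (φ X)⁻¹ ≠ 0) :
    φ X ^ Fintype.card Fq ^ (d + 1) * (carlitzPoly φ d).eval (φ X)⁻¹ ^ (Fintype.card Fq - 1) =
      φ X * φ (carlitzD Fq d) ^ (Fintype.card Fq - 1) := by
  have hX : φ X ≠ 0 := (map_ne_zero_iff φ hφ).2 X_ne_zero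
  have h1 := eval_carlitzPoly_succ_mul hφ d (φ X)⁻¹
  rw [mul_inv_cancel₀ hX, eval_carlitzPoly_one hφ, eval_carlitzPoly_succ hφ] at h1
  have h4 : (carlitzPoly φ d).eval (φ X)⁻¹ ^ Fintype.card Fq =
      (carlitzPoly φ d).eval (φ X)⁻¹ ^ (Fintype.card Fq - 1) * (carlitzPoly φ d).eval (φ X)⁻¹ := by
    rw [← pow_succ, Nat.sub_add_cancel Fintype.card_pos]
  rw [h4] at h1
  refine mul_right_cancel₀ h ?_
  linear_combination -h1

/-! ### Factorization over the polynomials of degree `< d` -/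

theorem prod_sub_map_mul (φ : Fq →+* K) (x y : K) :
    ∏ c : Fq, (x - φ c * y) = x ^ Fintype.card Fq - y ^ (Fintype.card Fq - 1) * x := by
  rcases eq_or_ne y 0 with rfl | hy
  · simp [Finset.prod_const, zero_pow (Nat.sub_pos_of_lt (Fintype.one_lt_card (α := Fq))).ne']
  have h : ∏ c : Fq, (X - C c) = X ^ Fintype.card Fq - X := by
    have hm : (X ^ Fintype.card Fq - X : Fq[X]).Monic :=
      monic_X_pow_sub (by simpa using Fintype.one_lt_card)
    have := prod_multiset_X_sub_C_of_monic_of_roots_card_eq hm (by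
      rw [FiniteField.roots_X_pow_card_sub_X,
        FiniteField.X_pow_card_sub_X_natDegree_eq _ Fintype.one_lt_card]
      simp)
    rwa [FiniteField.roots_X_pow_card_sub_X] at this
  have h2 := congrArg (fun p => p.eval₂ φ (x / y)) h
  simp only [eval₂_finsetProd, eval₂_sub, eval₂_X, eval₂_C, eval₂_X_pow] at h2
  have h3 : ∏ c : Fq, (x - φ c * y) = y ^ Fintype.card Fq * ∏ c : Fq, (x / y - φ c) := by
    rw [← Finset.card_univ, ← Finset.prod_const, ← Finset.prod_mul_distrib]
    exact Finset.prod_congr rfl fun c _ => by field_simp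
  have h4 : y ^ Fintype.card Fq = y ^ (Fintype.card Fq - 1) * y := by
    rw [← pow_succ, Nat.sub_add_cancel Fintype.card_pos]
  rw [h3, h2, mul_sub, div_pow, mul_div_cancel₀ _ (pow_ne_zero _ hy), h4, mul_assoc,
    mul_div_cancel₀ _ hy]

/-- The polynomials of degree `< d`. -/
def polyDegreeLT (Fq : Type*) [Field Fq] [Fintype Fq] (d : ℕ) : Finset Fq[X] :=
  have : Finite (degreeLT Fq d) := Finite.of_equiv _ (degreeLTEquiv Fq d).toEquiv.symm
  (degreeLT Fq d : Set Fq[X]).toFinite.toFinset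

theorem mem_polyDegreeLT {d : ℕ} {A : Fq[X]} : A ∈ polyDegreeLT Fq d ↔ A.degree < d := by
  simp [polyDegreeLT, mem_degreeLT]

theorem prod_polyDegreeLT_succ {M : Type*} [CommMonoid M] (d : ℕ) (f : Fq[X] → M) :
    ∏ A ∈ polyDegreeLT Fq (d + 1), f A =
      ∏ c : Fq, ∏ A ∈ polyDegreeLT Fq d, f (C c * X ^ d + A) := by
  rw [← Finset.prod_product']
  refine Finset.prod_bij' (fun A _ => (A.coeff d, A - C (A.coeff d) * X ^ d))
    (fun p _ => C p.1 * X ^ d + p.2) ?_ ?_ ?_ ?_ ?_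
  · intro A hA
    simp only [Finset.mem_product, Finset.mem_univ, true_and, mem_polyDegreeLT] at hA ⊢
    rw [degree_lt_iff_coeff_zero] at hA ⊢
    intro m hm
    rcases hm.eq_or_lt with rfl | h
    · simp
    · simp [hA m h, coeff_X_pow, h.ne']
  · intro p hp
    simp only [Finset.mem_product, Finset.mem_univ, true_and, mem_polyDegreeLT] at hp ⊢
    refine (degree_add_le _ _).trans_lt (max_lt ?_ (hp.trans (by exact_mod_cast d.lt_succ_self)))
    exact (degree_C_mul_X_pow_le _ _).trans_lt (by exact_mod_cast d.lt_succ_self)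
  · intro A _
    simp
  · intro p hp
    simp only [Finset.mem_product, Finset.mem_univ, true_and, mem_polyDegreeLT] at hp
    have : p.2.coeff d = 0 := coeff_eq_zero_of_degree_lt hp
    ext <;> simp [this]
  · intro A _
    simp

/-- Writing the roots as `c T^d + A` with `deg A < d`, linearity turns the inner product into
`e_d(z) - c D_d`; the product over `c` is then the recursion for `e_{d+1}`. -/
theorem eval_carlitzPoly_eq_prod {φ : Fq[X] →+* K} (hφ : Function.Injective φ) (d : ℕ) (z : K) :
    (carlitzPoly φ d).eval z = ∏ A ∈ polyDegreeLT Fq d, (z - φ A) := by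
  induction d generalizing z with
  | zero =>
    have : polyDegreeLT Fq 0 = {0} := by
      ext A
      simp [mem_polyDegreeLT, Nat.WithBot.lt_zero_iff]
    simp [this, eval_carlitzPoly, carlitzCoeff_self hφ]
  | succ d ih =>
    rw [prod_polyDegreeLT_succ, eval_carlitzPoly_succ hφ, ← prod_sub_map_mul (φ.comp C)]
    refine Finset.prod_congr rfl fun c _ => ?_
    have := ih (z - φ (C c * X ^ d))
    rw [eval_carlitzPoly_sub, map_mul, eval_carlitzPoly_C_mul, map_pow,
      eval_carlitzPoly_X_pow hφ] at this
    rw [RingHom.comp_apply, this]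
    exact Finset.prod_congr rfl fun A _ => by rw [map_add, map_mul, map_pow, sub_sub]

end Carlitz

theorem coeff_prod_one_add_C_mul_X {ι R : Type*} [CommRing R] (s : Finset ι) (f : ι → R) (l : ℕ) :
    (∏ i ∈ s, (1 + C (f i) * X)).coeff l = ∑ t ∈ s.powersetCard l, ∏ i ∈ t, f i := by
  rw [Finset.prod_one_add, finsetSum_coeff, Finset.powersetCard_eq_filter, Finset.sum_filter]
  refine Finset.sum_congr rfl fun t _ => ?_
  rw [Finset.prod_mul_distrib, Finset.prod_const, ← map_prod, coeff_C_mul_X_pow]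
  simp only [eq_comm]

/-! ### Finite symmetric functions over monic polynomials -/

section Carlitz

variable {Fq K : Type*} [Field Fq] [Fintype Fq] [Field K]

open Classical in
/-- The nonzero polynomials of degree `< d`. -/
def nonzeroDegreeLT (Fq : Type*) [Field Fq] [Fintype Fq] (d : ℕ) : Finset {A : Fq[X] // A ≠ 0} :=
  (polyDegreeLT Fq d).subtype (· ≠ 0)

open Classical in
/-- The monic polynomials of degree `< d`. -/
def monicDegreeLT (Fq : Type*) [Field Fq] [Fintype Fq] (d : ℕ) :
    Finset {A : Fq[X] // A.Monic} :=
  (polyDegreeLT Fq d).subtype Monic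

theorem mem_nonzeroDegreeLT {d : ℕ} {A : {A : Fq[X] // A ≠ 0}} :
    A ∈ nonzeroDegreeLT Fq d ↔ A.1.degree < d := by
  simp [nonzeroDegreeLT, mem_polyDegreeLT]

theorem mem_monicDegreeLT {d : ℕ} {A : {A : Fq[X] // A.Monic}} :
    A ∈ monicDegreeLT Fq d ↔ A.1.degree < d := by
  simp [monicDegreeLT, mem_polyDegreeLT]

theorem prod_polyDegreeLT {M : Type*} [CommMonoid M] (d : ℕ) (f : Fq[X] → M) :
    ∏ A ∈ polyDegreeLT Fq d, f A = f 0 * ∏ A ∈ nonzeroDegreeLT Fq d, f A.1 := by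
  classical
  rw [nonzeroDegreeLT, Finset.prod_subtype_eq_prod_filter, Finset.filter_ne',
    Finset.mul_prod_erase _ _ (by simp [mem_polyDegreeLT, bot_lt_iff_ne_bot])]

/-- The scalar is inverted so that `1 - z / (c⁻¹ A)` becomes `1 - c (z / A)`, the shape of
`prod_sub_map_mul`. -/
theorem prod_nonzeroDegreeLT [DecidableEq Fq] {M : Type*} [CommMonoid M] (d : ℕ)
    (f : Fq[X] → M) : ∏ A ∈ nonzeroDegreeLT Fq d, f A.1 =
      ∏ A ∈ monicDegreeLT Fq d, ∏ c ∈ Finset.univ.erase (0 : Fq), f (C c⁻¹ * A.1) := by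
  rw [← Finset.prod_product']
  refine Finset.prod_bij' (fun A _ => (⟨A.1 * C A.1.leadingCoeff⁻¹,
      monic_mul_leadingCoeff_inv A.2⟩, A.1.leadingCoeff⁻¹))
    -- The value at `c = 0` is a dummy: that scalar is erased from the index set.
    (fun p _ => if h : p.2 = 0 then ⟨1, one_ne_zero⟩ else
      ⟨C p.2⁻¹ * p.1.1, mul_ne_zero (by simpa using h) p.1.2.ne_zero⟩) ?_ ?_ ?_ ?_ ?_
  · intro A hA
    have := A.2
    simpa [mem_monicDegreeLT, mem_nonzeroDegreeLT, degree_mul_leadingCoeff_inv, this] using hA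
  · rintro ⟨p, c⟩ hp
    have hc : c ≠ 0 := by simpa using (Finset.mem_product.1 hp).2
    have hp' := mem_monicDegreeLT.1 (Finset.mem_product.1 hp).1
    simpa [hc, mem_nonzeroDegreeLT, degree_C] using hp'
  · intro A hA
    have := A.2
    simp only [inv_eq_zero, leadingCoeff_eq_zero, this, dite_false, inv_inv]
    ext1
    simp only
    rw [mul_left_comm, ← C_mul, mul_inv_cancel₀ (by simpa using this), C_1, mul_one]
  · rintro ⟨p, c⟩ hp
    have hc : c ≠ 0 := by simpa using (Finset.mem_product.1 hp).2
    have hp' := p.2.leadingCoeff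
    simp only [hc, dite_false, leadingCoeff_mul, leadingCoeff_C, hp', mul_one, inv_inv]
    refine Prod.ext (Subtype.ext ?_) rfl
    simp only
    rw [mul_right_comm, ← C_mul, inv_mul_cancel₀ hc, C_1, one_mul]
  · intro A hA
    have := A.2
    simp only [inv_inv]
    rw [mul_left_comm, ← C_mul, mul_inv_cancel₀ (by simpa using this), C_1, mul_one]

theorem prod_one_sub_div_nonzeroDegreeLT (φ : Fq[X] →+* K) (d : ℕ) (z : K) :
    ∏ A ∈ nonzeroDegreeLT Fq d, (1 - z / φ A.1) =
      ∏ A ∈ monicDegreeLT Fq d, (1 - (z / φ A.1) ^ (Fintype.card Fq - 1)) := by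
  classical
  rw [prod_nonzeroDegreeLT d fun A => 1 - z / φ A]
  refine Finset.prod_congr rfl fun A _ => ?_
  have h := prod_sub_map_mul (φ.comp C) 1 (z / φ A.1)
  rw [← Finset.mul_prod_erase _ _ (Finset.mem_univ (0 : Fq))] at h
  simp only [map_zero, zero_mul, sub_zero, one_mul, one_pow, mul_one] at h
  rw [← h]
  refine Finset.prod_congr rfl fun c _ => ?_
  rw [map_mul, ← RingHom.comp_apply, map_inv₀, mul_comm _ (φ A.1), ← div_div, div_inv_eq_mul,
    mul_comm]

theorem eval_carlitzPoly_eq_mul_prod {φ : Fq[X] →+* K} (hφ : Function.Injective φ) (d : ℕ) :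
    ∃ κ : K, ∀ z, (carlitzPoly φ d).eval z =
      κ * z * ∏ A ∈ nonzeroDegreeLT Fq d, (1 - z / φ A.1) := by
  refine ⟨∏ A ∈ nonzeroDegreeLT Fq d, -φ A.1, fun z => ?_⟩
  rw [eval_carlitzPoly_eq_prod hφ, prod_polyDegreeLT d fun A => z - φ A, map_zero, sub_zero,
    mul_comm _ z, mul_assoc, ← Finset.prod_mul_distrib]
  congr 1
  refine Finset.prod_congr rfl fun A _ => ?_
  have : φ A.1 ≠ 0 := (map_ne_zero_iff φ hφ).2 A.2
  field_simp
  ring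

theorem coeff_carlitzPoly (φ : Fq[X] →+* K) (d n : ℕ) : (carlitzPoly φ d).coeff n =
    ∑ i ∈ Finset.range (d + 1), if n = Fintype.card Fq ^ i then carlitzCoeff φ d i else 0 := by
  simp only [carlitzPoly, finsetSum_coeff, coeff_C_mul_X_pow]

theorem coeff_carlitzPoly_pow (φ : Fq[X] →+* K) (d j : ℕ) :
    (carlitzPoly φ d).coeff (Fintype.card Fq ^ j) = carlitzCoeff φ d j := by
  simp only [coeff_carlitzPoly, (Nat.pow_right_injective Fintype.one_lt_card).eq_iff]
  rw [Finset.sum_ite_eq]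
  split_ifs with h
  · rfl
  · rw [carlitzCoeff_of_lt]
    simpa [Nat.lt_succ_iff] using h

theorem carlitzPoly_eq_mul_expand {φ : Fq[X] →+* K} (hφ : Function.Injective φ) (d : ℕ) {κ : K}
    (hκ : ∀ z, (carlitzPoly φ d).eval z =
      κ * z * ∏ A ∈ nonzeroDegreeLT Fq d, (1 - z / φ A.1)) :
    carlitzPoly φ d = C κ * (expand K (Fintype.card Fq - 1)
      (∏ A ∈ monicDegreeLT Fq d, (1 + C (-(1 / φ A.1 ^ (Fintype.card Fq - 1))) * X)) * X) := by
  -- Over an infinite field, equality of values gives equality of polynomials.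
  have : Infinite K := Infinite.of_injective φ hφ
  refine Polynomial.funext fun z => ?_
  rw [hκ, prod_one_sub_div_nonzeroDegreeLT]
  simp only [eval_mul, eval_C, eval_X, expand_eval, eval_prod, eval_add, eval_one, mul_assoc,
    mul_comm z]
  congr 2
  refine Finset.prod_congr rfl fun A _ => ?_
  rw [div_pow]
  ring

theorem coeff_carlitzPoly_eq_mul_sum {φ : Fq[X] →+* K} (hφ : Function.Injective φ) (d l : ℕ)
    {κ : K} (hκ : ∀ z, (carlitzPoly φ d).eval z =
      κ * z * ∏ A ∈ nonzeroDegreeLT Fq d, (1 - z / φ A.1)) :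
    (carlitzPoly φ d).coeff (l * (Fintype.card Fq - 1) + 1) = κ * ((-1) ^ l *
      ∑ s ∈ (monicDegreeLT Fq d).powersetCard l,
        ∏ A ∈ s, 1 / φ A.1 ^ (Fintype.card Fq - 1)) := by
  rw [carlitzPoly_eq_mul_expand hφ d hκ, coeff_C_mul, coeff_mul_X,
    coeff_expand_mul (Nat.sub_pos_of_lt Fintype.one_lt_card), coeff_prod_one_add_C_mul_X]
  congr 1
  rw [Finset.mul_sum]
  refine Finset.sum_congr rfl fun s hs => ?_
  rw [Finset.prod_neg, (Finset.mem_powersetCard.1 hs).2]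

theorem eval_carlitzPoly_eq_carlitzCoeff_mul_prod {φ : Fq[X] →+* K} (hφ : Function.Injective φ)
    (d : ℕ) (z : K) : (carlitzPoly φ d).eval z =
      carlitzCoeff φ d 0 * z * ∏ A ∈ nonzeroDegreeLT Fq d, (1 - z / φ A.1) := by
  obtain ⟨κ, hκ⟩ := eval_carlitzPoly_eq_mul_prod hφ d
  -- The case `l = 0` compares coefficients of `z` and identifies `κ` as `c_{d,0}`.
  have h := coeff_carlitzPoly_eq_mul_sum hφ d 0 hκ
  have h0 := coeff_carlitzPoly_pow φ d 0
  simp only [zero_mul, zero_add, pow_zero, Finset.powersetCard_zero, Finset.sum_singleton,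
    Finset.prod_empty, mul_one] at h h0
  rw [← h0, h, hκ]

/-- The finite elementary symmetric functions vanish unless `l = (q ^ j - 1) / (q - 1)`. -/
theorem sum_powersetCard_monicDegreeLT_eq_zero {φ : Fq[X] →+* K} (hφ : Function.Injective φ)
    (d l : ℕ) (hl : ∀ j, l * (Fintype.card Fq - 1) + 1 ≠ Fintype.card Fq ^ j) :
    ∑ s ∈ (monicDegreeLT Fq d).powersetCard l,
      ∏ A ∈ s, 1 / φ A.1 ^ (Fintype.card Fq - 1) = 0 := by
  have h := coeff_carlitzPoly_eq_mul_sum hφ d l (eval_carlitzPoly_eq_carlitzCoeff_mul_prod hφ d)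
  rw [coeff_carlitzPoly, Finset.sum_eq_zero fun i _ => if_neg (hl i)] at h
  simpa [carlitzCoeff_zero_ne_zero hφ] using h.symm

theorem sum_powersetCard_monicDegreeLT {φ : Fq[X] →+* K} (hφ : Function.Injective φ)
    (j k l : ℕ) (hl : l * (Fintype.card Fq - 1) + 1 = Fintype.card Fq ^ j) :
    ∑ s ∈ (monicDegreeLT Fq (j + k)).powersetCard l,
      ∏ A ∈ s, 1 / φ A.1 ^ (Fintype.card Fq - 1) = (-1) ^ l * (-1) ^ j * φ (carlitzL Fq (j + k)) /
        (φ (carlitzD Fq j) * φ (carlitzL Fq k) ^ Fintype.card Fq ^ j) := by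
  have h := coeff_carlitzPoly_eq_mul_sum hφ (j + k) l
    (eval_carlitzPoly_eq_carlitzCoeff_mul_prod hφ (j + k))
  rw [hl, coeff_carlitzPoly_pow, carlitzCoeff_add, carlitzCoeff_zero_right] at h
  have hD (j) : φ (carlitzD Fq j) ≠ 0 := (map_ne_zero_iff φ hφ).2 (carlitzD_ne_zero j)
  have hL (j) : φ (carlitzL Fq j) ≠ 0 := (map_ne_zero_iff φ hφ).2 (carlitzL_ne_zero j)
  have h1 := hD j
  have h2 := hD (j + k)
  have h3 := hL k
  have h4 := hL (j + k)
  have e (n : ℕ) : (-1 : K) ^ n * (-1) ^ n = 1 := by rw [← mul_pow]; simp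
  have e1 := e l
  have e2 := e j
  have e3 := e k
  set S := ∑ s ∈ (monicDegreeLT Fq (j + k)).powersetCard l,
      ∏ A ∈ s, 1 / φ A.1 ^ (Fintype.card Fq - 1)
  rw [pow_add] at h
  field_simp at h ⊢
  generalize (-1 : K) ^ l = a at *
  generalize (-1 : K) ^ k = b at *
  generalize (-1 : K) ^ j = c at *
  linear_combination (-(c * a)) * h -
    φ (carlitzD Fq j) * φ (carlitzL Fq k) ^ Fintype.card Fq ^ j * S * (a * a * e2 + e1)

/-- The product is `e_d(1/T)` divided by `c_{d,0} / T`. In the `(q-1)`-st power the sign of `c_{d,0}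
= ± D_d / L_d` disappears and `D_d` cancels. -/
theorem prod_nonzeroDegreeLT_pow {φ : Fq[X] →+* K} (hφ : Function.Injective φ) (d : ℕ) :
    (∏ A ∈ nonzeroDegreeLT Fq d, (1 - (φ (X * A.1))⁻¹)) ^ (Fintype.card Fq - 1) *
      φ X ^ Fintype.card Fq ^ (d + 1) =
      φ X ^ Fintype.card Fq * φ (carlitzL Fq d) ^ (Fintype.card Fq - 1) := by
  have hX : φ X ≠ 0 := (map_ne_zero_iff φ hφ).2 X_ne_zero
  have hX' (A : {A : Fq[X] // A ≠ 0}) : 1 - (φ X)⁻¹ / φ A.1 ≠ 0 := by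
    rw [sub_ne_zero, ne_comm, div_eq_mul_inv, ← mul_inv, ← map_mul, ne_eq, inv_eq_one,
      ← map_one φ, hφ.eq_iff]
    intro h
    exact not_isUnit_X (IsUnit.of_mul_eq_one _ h)
  have hD : φ (carlitzD Fq d) ≠ 0 := (map_ne_zero_iff φ hφ).2 (carlitzD_ne_zero d)
  have hL : φ (carlitzL Fq d) ≠ 0 := (map_ne_zero_iff φ hφ).2 (carlitzL_ne_zero d)
  have he := eval_carlitzPoly_eq_carlitzCoeff_mul_prod hφ d (φ X)⁻¹
  have h0 : (carlitzPoly φ d).eval (φ X)⁻¹ ≠ 0 := by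
    rw [he]
    exact mul_ne_zero (mul_ne_zero (carlitzCoeff_zero_ne_zero hφ d) (inv_ne_zero hX))
      (Finset.prod_ne_zero_iff.2 fun A _ => hX' A)
  have h1 := eval_carlitzPoly_inv_pow hφ d h0
  have hs : ((-1 : K) ^ d) ^ (Fintype.card Fq - 1) = 1 := by
    rw [pow_right_comm, neg_one_pow_fintypeCard_sub_one (φ.comp C), one_pow]
  have hq : φ X ^ Fintype.card Fq = φ X ^ (Fintype.card Fq - 1) * φ X := by
    rw [← pow_succ, Nat.sub_add_cancel Fintype.card_pos]
  simp only [map_mul, mul_inv, div_eq_mul_inv] at he ⊢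
  rw [he, carlitzCoeff_zero_right] at h1
  simp only [mul_pow, div_pow, hs, inv_pow] at h1
  rw [hq]
  field_simp at h1 ⊢
  linear_combination h1

end Carlitz

/-! ### Nonarchimedean convergence -/

section Valued

open Filter Topology

variable {K Γ₀ : Type*} [Field K] [LinearOrderedCommGroupWithZero Γ₀] [Valued K Γ₀]

theorem Valued.nonarchimedeanAddGroup : NonarchimedeanAddGroup K where
  is_nonarchimedean U hU := by
    obtain ⟨γ, hγ⟩ := Valued.mem_nhds_zero.1 hU
    exact ⟨⟨Valuation.ltAddSubgroup Valued.v.restrict γ, Valued.isOpen_ball K γ.1⟩, hγ⟩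

/-- With all factors of valuation at most `1`, one small factor makes the product small. A set with
a large product therefore lies inside the finite set of indices with large `f i`, which has finitely
many subsets. -/
theorem Valued.tendsto_cofinite_finset_prod {ι : Type*} {f : ι → K}
    (hf : Tendsto f cofinite (𝓝 0)) (h1 : ∀ i, Valued.v (f i) ≤ 1) :
    Tendsto (fun s : Finset ι => ∏ i ∈ s, f i) cofinite (𝓝 0) := by
  classical
  intro U hU
  obtain ⟨γ, hγ⟩ := Valued.mem_nhds_zero.1 hU
  have hfin : {i | ¬ Valued.v.restrict (f i) < γ.1}.Finite :=
    hf (Valued.mem_nhds_zero.2 ⟨γ, subset_rfl⟩)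
  refine (Finset.finite_toSet hfin.toFinset.powerset).subset fun s hs => ?_
  rw [Finset.mem_coe, Finset.mem_powerset]
  intro i hi
  rw [Set.Finite.mem_toFinset]
  intro hlt
  refine hs (hγ ?_)
  change Valued.v.restrict (∏ i ∈ s, f i) < γ.1
  rw [← Finset.mul_prod_erase s f hi, map_mul, map_prod]
  refine (mul_le_of_le_one_right' (Finset.prod_le_one' fun j _ => ?_)).trans_lt hlt
  exact (Valued.v.restrict_le_one_iff).2 (h1 j)

theorem Valued.summable_finset_prod [CompleteSpace K] {ι : Type*} {f : ι → K}
    (hf : Tendsto f cofinite (𝓝 0)) (h1 : ∀ i, Valued.v (f i) ≤ 1) :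
    Summable fun s : Finset ι => ∏ i ∈ s, f i :=
  have := Valued.nonarchimedeanAddGroup (K := K)
  NonarchimedeanAddGroup.summable_of_tendsto_cofinite_zero
    (Valued.tendsto_cofinite_finset_prod hf h1)

theorem Valued.ne_zero_of_tendsto {ι : Type*} {F : Filter ι} [F.NeBot] {f : ι → K} {a : K}
    (hf : Tendsto f F (𝓝 a)) (h1 : ∀ i, Valued.v (f i) = 1) : a ≠ 0 := by
  rintro rfl
  obtain ⟨i, hi⟩ := (hf.eventually_mem (Valued.mem_nhds_zero.2 ⟨1, subset_rfl⟩)).exists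
  have : Valued.v.restrict (f i) < 1 := hi
  rw [Valuation.restrict_lt_one_iff, h1] at this
  exact this.false

end Valued

theorem HasSum.tendsto_sum_powersetCard {ι R : Type*} [CommRing R] [TopologicalSpace R] {l : ℕ}
    {x : ι → R} {a : R} (h : HasSum (fun s : {s : Finset ι // s.card = l} => ∏ i ∈ s.1, x i) a)
    {S : ℕ → Finset ι} (hS : Monotone S) (hS' : ∀ i, ∃ n, i ∈ S n) :
    Filter.Tendsto (fun n => ∑ s ∈ (S n).powersetCard l, ∏ i ∈ s, x i) Filter.atTop (nhds a) := by
  have ht : Filter.Tendsto (fun n => ((S n).powersetCard l).subtype (·.card = l))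
      Filter.atTop Filter.atTop := by
    refine Filter.tendsto_atTop_finset_of_monotone ?_ ?_
    · exact fun m n hmn => Finset.subtype_mono (Finset.powersetCard_mono (hS hmn))
    · rintro ⟨s, hs⟩
      have := Filter.tendsto_atTop.1 (Filter.tendsto_atTop_finset_of_monotone hS hS') s
      obtain ⟨n, hn⟩ := this.exists
      exact ⟨n, by simpa [Finset.mem_powersetCard, hs] using hn⟩
  refine (h.comp ht).congr fun n => ?_
  exact Finset.sum_subtype_of_mem (fun s => ∏ i ∈ s, x i) fun s hs => (Finset.mem_powersetCard.1 hs).2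

/-! ### Exhaustion by degree and the finite formula prepared for the limit -/

section Carlitz

variable {Fq : Type*} [Field Fq] [Fintype Fq]

theorem exists_mem_polyDegreeLT (A : Fq[X]) : ∃ n, A ∈ polyDegreeLT Fq n :=
  ⟨A.natDegree + 1, mem_polyDegreeLT.2
    (A.degree_le_natDegree.trans_lt (by exact_mod_cast A.natDegree.lt_succ_self))⟩

theorem monotone_nonzeroDegreeLT : Monotone (nonzeroDegreeLT Fq) := fun _ _ h _ hA =>
  mem_nonzeroDegreeLT.2 ((mem_nonzeroDegreeLT.1 hA).trans_le (by exact_mod_cast h))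

theorem monotone_monicDegreeLT : Monotone (monicDegreeLT Fq) := fun _ _ h _ hA =>
  mem_monicDegreeLT.2 ((mem_monicDegreeLT.1 hA).trans_le (by exact_mod_cast h))

theorem exists_mem_nonzeroDegreeLT (A : {A : Fq[X] // A ≠ 0}) : ∃ n, A ∈ nonzeroDegreeLT Fq n := by
  simpa [nonzeroDegreeLT] using exists_mem_polyDegreeLT A.1

theorem exists_mem_monicDegreeLT (A : {A : Fq[X] // A.Monic}) : ∃ n, A ∈ monicDegreeLT Fq n := by
  simpa [monicDegreeLT] using exists_mem_polyDegreeLT A.1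

theorem carlitzL_add (k j : ℕ) : carlitzL Fq (k + j) = carlitzL Fq k *
    ∏ m ∈ Finset.range j, (X ^ Fintype.card Fq ^ (k + m + 1) - X) := by
  simp [carlitzL, Finset.prod_range_add]

theorem neg_one_pow_eq_of_mul_card_sub_one {K : Type*} [CommRing K] (φ : Fq →+* K) {j l : ℕ}
    (hl : l = ∑ m ∈ Finset.range j, Fintype.card Fq ^ m) : (-1 : K) ^ l = (-1) ^ j := by
  rw [hl, ← Finset.prod_pow_eq_pow_sum]
  simp [neg_one_pow_fintypeCard_pow φ]

/-- The growing quantities must cancel before `k → ∞`. Since `q^j = 1 + l(q-1)`, `L_k^(q^j) = L_k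
(L_k^(q-1))^l`; also `L_{k+j}` is `L_k (T^(q^(k+1)))^l` times factors tending to `1`. In the
quotient, `prod_nonzeroDegreeLT_pow` replaces `(T^(q^(k+1)) / L_k^(q-1))^l` by the partial period
product. -/
theorem sum_powersetCard_monicDegreeLT_eq_prod {K : Type*} [Field K] {φ : Fq[X] →+* K}
    (hφ : Function.Injective φ) (j k l : ℕ)
    (hl : l = ∑ m ∈ Finset.range j, Fintype.card Fq ^ m) :
    ∑ s ∈ (monicDegreeLT Fq (k + j)).powersetCard l,
      ∏ A ∈ s, 1 / φ A.1 ^ (Fintype.card Fq - 1) =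
      (-1) ^ l / φ (carlitzD Fq j) *
        (∏ m ∈ Finset.range j, (1 - φ X * (φ (X ^ Fintype.card Fq ^ (k + m + 1)))⁻¹)) *
        (-φ X ^ Fintype.card Fq /
          (∏ A ∈ nonzeroDegreeLT Fq k, (1 - (φ (X * A.1))⁻¹)) ^ (Fintype.card Fq - 1)) ^ l := by
  have hq : Fintype.card Fq - 1 + 1 = Fintype.card Fq := Nat.sub_add_cancel Fintype.card_pos
  have hl' : l * (Fintype.card Fq - 1) + 1 = Fintype.card Fq ^ j := by
    have := geom_sum_mul_add (Fintype.card Fq - 1) j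
    rwa [hq, ← hl] at this
  have hX : φ X ≠ 0 := (map_ne_zero_iff φ hφ).2 X_ne_zero
  have hD (j) : φ (carlitzD Fq j) ≠ 0 := (map_ne_zero_iff φ hφ).2 (carlitzD_ne_zero j)
  have hL (j) : φ (carlitzL Fq j) ≠ 0 := (map_ne_zero_iff φ hφ).2 (carlitzL_ne_zero j)
  have hQ := prod_nonzeroDegreeLT_pow hφ k
  set Q := ∏ A ∈ nonzeroDegreeLT Fq k, (1 - (φ (X * A.1))⁻¹)
  set P := ∏ m ∈ Finset.range j, (1 - φ X * (φ (X ^ Fintype.card Fq ^ (k + m + 1)))⁻¹) with hP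
  have hQ0 : Q ^ (Fintype.card Fq - 1) ≠ 0 := by
    intro h0
    rw [h0, zero_mul] at hQ
    exact mul_ne_zero (pow_ne_zero _ hX) (pow_ne_zero _ (hL k)) hQ.symm
  have hLk : φ (carlitzL Fq (k + j)) = φ (carlitzL Fq k) *
      ((φ X ^ Fintype.card Fq ^ (k + 1)) ^ l * P) := by
    rw [carlitzL_add, map_mul, map_prod, hl, ← Finset.prod_pow_eq_pow_sum, hP,
      ← Finset.prod_mul_distrib]
    congr 1
    refine Finset.prod_congr rfl fun m _ => ?_
    rw [← pow_mul, ← pow_add, add_right_comm k 1 m, map_sub, map_pow]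
    field_simp
  have hLq : φ (carlitzL Fq k) ^ Fintype.card Fq ^ j =
      φ (carlitzL Fq k) * (φ (carlitzL Fq k) ^ (Fintype.card Fq - 1)) ^ l := by
    rw [← hl', pow_succ', ← pow_mul, mul_comm l]
  rw [add_comm k j, sum_powersetCard_monicDegreeLT hφ j k l hl', add_comm j k, hLk, hLq,
    ← neg_one_pow_eq_of_mul_card_sub_one (φ.comp C) hl, div_pow,
    neg_pow (φ X ^ Fintype.card Fq)]
  have hQl : (Q ^ (Fintype.card Fq - 1)) ^ l * (φ X ^ Fintype.card Fq ^ (k + 1)) ^ l =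
      (φ X ^ Fintype.card Fq) ^ l * (φ (carlitzL Fq k) ^ (Fintype.card Fq - 1)) ^ l := by
    rw [← mul_pow, hQ, mul_pow]
  have h1 := pow_ne_zero l hQ0
  have h2 := pow_ne_zero l (pow_ne_zero (Fintype.card Fq - 1) (hL k))
  have h3 := hL k
  have h4 := hD j
  generalize (Q ^ (Fintype.card Fq - 1)) ^ l = a at *
  generalize (φ X ^ Fintype.card Fq ^ (k + 1)) ^ l = b at *
  generalize (φ X ^ Fintype.card Fq) ^ l = c at *
  generalize (φ (carlitzL Fq k) ^ (Fintype.card Fq - 1)) ^ l = d at *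
  field_simp
  linear_combination P * hQl

end Carlitz

/-! ### Passage to the limit in the completion at infinity -/

section Infinity

open Filter Topology WithZero

variable (Fq : Type*) [Field Fq] [DecidableEq (RatFunc Fq)]

open RatFunc.CompletionAtInfty in
instance completeSpace_completionAtInfty : CompleteSpace (RatFunc.CompletionAtInfty Fq) :=
  inferInstanceAs (CompleteSpace (UniformSpace.Completion (RatFunc Fq)))

theorem polyToInfty_injective : Function.Injective (polyToInfty Fq) :=
  (algebraMap (RatFunc Fq) (RatFunc.CompletionAtInfty Fq)).injective.comp
    (IsFractionRing.injective Fq[X] (RatFunc Fq))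

variable {Fq}

theorem valued_algebraMap_completionAtInfty (x : RatFunc Fq) :
    Valued.v (algebraMap (RatFunc Fq) (RatFunc.CompletionAtInfty Fq) x) =
      RatFunc.inftyValuation Fq x := by
  let := RatFunc.inftyValued Fq
  exact Valued.valuedCompletion_apply x

theorem valued_polyToInfty {A : Fq[X]} (hA : A ≠ 0) :
    Valued.v (polyToInfty Fq A) = exp (A.natDegree : ℤ) := by
  rw [polyToInfty, RingHom.comp_apply, valued_algebraMap_completionAtInfty,
    RatFunc.inftyValuation_apply, RatFunc.inftyValuation.polynomial Fq hA]

theorem valued_inv_polyToInfty_le_one (A : Fq[X]) : Valued.v (polyToInfty Fq A)⁻¹ ≤ 1 := by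
  rcases eq_or_ne A 0 with rfl | hA
  · simp
  rw [map_inv₀, valued_polyToInfty hA, ← exp_neg, ← exp_zero, exp_le_exp]
  simp

theorem valued_periodFactor (A : {A : Fq[X] // A ≠ 0}) : Valued.v (periodFactor Fq A) = 1 := by
  refine Valuation.map_one_sub_of_lt _ ?_
  rw [map_inv₀, valued_polyToInfty (mul_ne_zero X_ne_zero A.2), natDegree_X_mul A.2, ← exp_neg,
    ← exp_zero, exp_lt_exp]
  push_cast
  lia

variable [Fintype Fq]

theorem tendsto_inv_polyToInfty {ι : Type*} {g : ι → Fq[X]} (hg : Function.Injective g) :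
    Tendsto (fun i => (polyToInfty Fq (g i))⁻¹) cofinite (𝓝 0) := by
  intro U hU
  obtain ⟨γ, hγ⟩ := Valued.mem_nhds_zero.1 hU
  set e := MonoidWithZeroHom.ValueGroup₀.embedding γ.1 with he
  have he0 : e ≠ 0 := by simp [he]
  -- As `1/A` has valuation `exp (-deg A)`, it falls below `e` once `deg A > -log e`; the `+ 1`
  -- makes this strict. Only finitely many polynomials have smaller degree.
  refine ((polyDegreeLT Fq ((-log e).toNat + 1)).finite_toSet.preimage hg.injOn).subset
    fun i hi => ?_
  rw [Set.mem_preimage, Finset.mem_coe]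
  by_contra hn
  refine hi (hγ ?_)
  rw [mem_polyDegreeLT] at hn
  have h0 : g i ≠ 0 := fun h => hn (by simp [h, bot_lt_iff_ne_bot])
  rw [degree_eq_natDegree h0, Nat.cast_lt] at hn
  change Valued.v.restrict _ < γ.1
  rw [Valuation.restrict_lt_iff_lt_embedding, ← he, map_inv₀, valued_polyToInfty h0, ← exp_neg,
    ← exp_log he0, exp_lt_exp]
  lia

theorem summable_prod_neg_inv_polyToInfty : Summable fun s : Finset {A : Fq[X] // A ≠ 0} =>
    ∏ A ∈ s, -(polyToInfty Fq (X * A.1))⁻¹ := by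
  refine Valued.summable_finset_prod ?_ fun A => ?_
  · simpa only [neg_zero] using
      (tendsto_inv_polyToInfty (g := fun A : {A : Fq[X] // A ≠ 0} => X * A.1)
        fun A B h => Subtype.ext (mul_left_cancel₀ X_ne_zero h)).neg
  · rw [Valuation.map_neg]
    exact valued_inv_polyToInfty_le_one _

theorem multipliable_periodFactor : Multipliable (periodFactor Fq) := by
  have h := multipliable_one_add_of_summable_prod (summable_prod_neg_inv_polyToInfty (Fq := Fq))
  simp only [← sub_eq_add_neg] at h
  exact h

/-- All partial products have valuation `1`, so they stay out of the open unit ball around `0`. -/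
theorem tprod_periodFactor_ne_zero : ∏' A, periodFactor Fq A ≠ 0 :=
  Valued.ne_zero_of_tendsto multipliable_periodFactor.hasProd fun s => by
    rw [map_prod]
    exact Finset.prod_eq_one fun A _ => valued_periodFactor A

theorem tendsto_prod_periodFactor :
    Tendsto (fun d => ∏ A ∈ nonzeroDegreeLT Fq d, (1 - (polyToInfty Fq (X * A.1))⁻¹)) atTop
      (𝓝 (∏' A, periodFactor Fq A)) :=
  Tendsto.comp (g := fun s => ∏ A ∈ s, periodFactor Fq A) multipliable_periodFactor.hasProd
    (tendsto_atTop_finset_of_monotone monotone_nonzeroDegreeLT exists_mem_nonzeroDegreeLT)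

theorem summable_prod_monicInvPow (l : ℕ) :
    Summable fun s : {s : Finset {A : Fq[X] // A.Monic} // s.card = l} =>
      ∏ A ∈ s.1, monicInvPow Fq A := by
  have h1 : Fintype.card Fq - 1 ≠ 0 := (Nat.sub_pos_of_lt Fintype.one_lt_card).ne'
  refine (Valued.summable_finset_prod (f := monicInvPow Fq) ?_ fun A => ?_).subtype _
  · rw [← zero_pow h1]
    refine ((tendsto_inv_polyToInfty Subtype.val_injective).pow (Fintype.card Fq - 1)).congr
      fun A => ?_
    rw [monicInvPow, one_div, inv_pow]
  · rw [monicInvPow, one_div, ← inv_pow, map_pow]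
    exact pow_le_one' (valued_inv_polyToInfty_le_one _) _

theorem tendsto_sum_monicInvPow (l : ℕ) :
    Tendsto (fun d => ∑ s ∈ (monicDegreeLT Fq d).powersetCard l,
      ∏ A ∈ s, 1 / polyToInfty Fq A.1 ^ (Fintype.card Fq - 1)) atTop
      (𝓝 (infiniteESymm l (monicInvPow Fq))) :=
  (summable_prod_monicInvPow l).hasSum.tendsto_sum_powersetCard monotone_monicDegreeLT
    exists_mem_monicDegreeLT

theorem infiniteESymm_monicInvPow_eq_zero {l : ℕ}
    (hl : ∀ j, l * (Fintype.card Fq - 1) + 1 ≠ Fintype.card Fq ^ j) :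
    infiniteESymm l (monicInvPow Fq) = 0 :=
  tendsto_nhds_unique (tendsto_sum_monicInvPow l) <| tendsto_const_nhds.congr fun d =>
    (sum_powersetCard_monicDegreeLT_eq_zero (polyToInfty_injective Fq) d l hl).symm

theorem tendsto_inv_polyToInfty_X_pow (m : ℕ) :
    Tendsto (fun k => (polyToInfty Fq (X ^ Fintype.card Fq ^ (k + m + 1)))⁻¹) atTop (𝓝 0) := by
  rw [← Nat.cofinite_eq_atTop]
  refine tendsto_inv_polyToInfty fun a b h => ?_
  have h2 := congrArg natDegree h
  simp only [natDegree_X_pow] at h2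
  have := Nat.pow_right_injective (Fintype.one_lt_card (α := Fq)) h2
  lia

theorem infiniteESymm_monicInvPow {j l : ℕ}
    (hl : l = ∑ m ∈ Finset.range j, Fintype.card Fq ^ m) :
    infiniteESymm l (monicInvPow Fq) = (-1) ^ l / polyToInfty Fq (carlitzD Fq j) *
      (-polyToInfty Fq X ^ Fintype.card Fq /
        (∏' A, periodFactor Fq A) ^ (Fintype.card Fq - 1)) ^ l := by
  refine tendsto_nhds_unique ((tendsto_add_atTop_iff_nat j).2 (tendsto_sum_monicInvPow l)) ?_
  simp only [sum_powersetCard_monicDegreeLT_eq_prod (polyToInfty_injective Fq) j _ l hl]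
  have hP : Tendsto (fun k => ∏ m ∈ Finset.range j, (1 - polyToInfty Fq X *
      (polyToInfty Fq (X ^ Fintype.card Fq ^ (k + m + 1)))⁻¹)) atTop (𝓝 1) := by
    have := tendsto_finsetProd (Finset.range j) fun m _ =>
      ((tendsto_inv_polyToInfty_X_pow (Fq := Fq) m).const_mul (polyToInfty Fq X)).const_sub 1
    simpa using this
  have hQ := (tendsto_const_nhds (x := -polyToInfty Fq X ^ Fintype.card Fq)).div
    (tendsto_prod_periodFactor.pow (Fintype.card Fq - 1))
    (pow_ne_zero _ (tprod_periodFactor_ne_zero (Fq := Fq)))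
  simpa using (hP.const_mul ((-1) ^ l / polyToInfty Fq (carlitzD Fq j))).mul (hQ.pow l)

/-- Only this power of the period enters the theorem; it lies in the completion and does not depend
on the chosen root, because `T^(q-1) r^(q-1) = -T^q`. -/
theorem carlitzPeriod_pow {L : Type*} [Field L] [Algebra (RatFunc.CompletionAtInfty Fq) L] {r : L}
    (hr : r ^ (Fintype.card Fq - 1) =
      -algebraMap (RatFunc.CompletionAtInfty Fq) L (polyToInfty Fq X)) :
    carlitzPeriod Fq r ^ (Fintype.card Fq - 1) = algebraMap (RatFunc.CompletionAtInfty Fq) L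
      (-polyToInfty Fq X ^ Fintype.card Fq /
        (∏' A, periodFactor Fq A) ^ (Fintype.card Fq - 1)) := by
  have hq : polyToInfty Fq X ^ Fintype.card Fq =
      polyToInfty Fq X ^ (Fintype.card Fq - 1) * polyToInfty Fq X := by
    rw [← pow_succ, Nat.sub_add_cancel Fintype.card_pos]
  rw [carlitzPeriod, div_pow, mul_pow, hr, hq]
  simp

end Infinity

end

/-- `r` is any `(q - 1)`-st root of `-T` in any field extension `L` of the `T⁻¹`-adic completion of
`𝔽_q(T)`. The first two conclusions say that the period is well defined, the third one that the
symmetric function converges. The division of `q ^ j - 1` by `q - 1` is exact. -/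
theorem proposition2p2 (Fq : Type*) [Field Fq] [Fintype Fq] [DecidableEq (RatFunc Fq)]
    (L : Type*) [Field L] [Algebra (RatFunc.CompletionAtInfty Fq) L]
    (r : L)
    (hr : r ^ (Fintype.card Fq - 1) =
      -algebraMap (RatFunc.CompletionAtInfty Fq) L (polyToInfty Fq Polynomial.X)) :
    Multipliable (periodFactor Fq) ∧ (∏' A, periodFactor Fq A) ≠ 0 ∧
    ∀ l : ℕ,
      (Summable fun s : {s : Finset {A : Polynomial Fq // A.Monic} // s.card = l} =>
        ∏ A ∈ s.1, monicInvPow Fq A) ∧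
      (∀ j : ℕ, l = (Fintype.card Fq ^ j - 1) / (Fintype.card Fq - 1) →
        algebraMap (RatFunc.CompletionAtInfty Fq) L (infiniteESymm l (monicInvPow Fq)) =
          (-1) ^ l * carlitzPeriod Fq r ^ (l * (Fintype.card Fq - 1)) /
            algebraMap (RatFunc.CompletionAtInfty Fq) L (polyToInfty Fq (carlitzD Fq j))) ∧
      ((¬ ∃ j : ℕ, l = (Fintype.card Fq ^ j - 1) / (Fintype.card Fq - 1)) →
        infiniteESymm l (monicInvPow Fq) = 0) := by
  refine ⟨multipliable_periodFactor, tprod_periodFactor_ne_zero, fun l =>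
    ⟨summable_prod_monicInvPow l, fun j hj => ?_, fun h => ?_⟩⟩
  -- The natural-number quotient is the geometric sum `1 + q + ... + q^(j-1)`.
  · rw [← Nat.geomSum_eq Fintype.one_lt_card] at hj
    rw [infiniteESymm_monicInvPow hj, mul_comm l, pow_mul, carlitzPeriod_pow hr, ← map_pow]
    simp only [map_mul, map_div₀, map_pow, map_neg, map_one]
    ring
  · refine infiniteESymm_monicInvPow_eq_zero fun j hj => h ⟨j, ?_⟩
    rw [← hj, Nat.add_sub_cancel, Nat.mul_div_cancel _ (Nat.sub_pos_of_lt Fintype.one_lt_card)]
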